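/- **Conventions.** Algebras are nonempty sets with finitary operations, in an arbitrary algebraic language; constant symbols are the nullary function symbols. For an algebra $\mathbf A$ and an integer $n\ge 1$, $d_{\mathbf A}(n)$ is the least cardinality of a generating set of the direct power $\mathbf A^n$; "$d$-functions" are regarded as functions on the positive integers. A term is *basic* if it contains at most one occurrence of a nonnullary function symbol, and an identity $s\approx t$ is *basic* if $s$ and $t$ are basic. An algebra $\mathbf A$ in a language $\mathcal K$ *realizes* a set $\Sigma$ of identities if the function symbols occurring in $\Sigma$ can be interpreted as $\mathcal K$-terms (an $m$-ary symbol as a term in $m$ variables, in particular a constant symbol as a variable-free term) so that every identity of $\Sigma$ holds in $\mathbf A$. $\Sigma\models\varphi$ means that every model of $\Sigma$ is a model of $\varphi$, and $\Sigma$ is *consistent* if $\Sigma\not\models x\approx y$ for distinct variables $x,y$ (that is, $\Sigma$ has a model with more than one element). If $\Sigma$ is a set of identities in a language $\mathcal L$, an $\mathcal L$-term $F(x_1,\dots,x_m)$ is a *$p$-pointed $k$-cube term* for the variety axiomatized by $\Sigma$ ($k\ge 1$) if there is a $k\times m$ matrix $M=[y_{i,j}]$ of variables and exactly $p$ distinct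 constant symbols of $\mathcal L$, each column of which contains a symbol different from the variable $x$, such that $\Sigma\models F(y_{i,1},\dots,y_{i,m})\approx x$ for $i=1,\dots,k$. It is a *pointed cube term* if it is a $p$-pointed $k$-cube term for some $p\ge 0$, $k\ge 1$. $\Sigma$ is *nonrestrictive* if for every algebra $\mathbf A$ there is an algebra $\mathbf B$ realizing $\Sigma$ with $d_{\mathbf B}(n)=d_{\mathbf A}(n)$ for all $n\ge 1$; otherwise $\Sigma$ is *restrictive*. $\Sigma$ is *nonrestrictive for finite algebras* if for every finite algebra $\mathbf A$ with more than one element there is a finite algebra $\mathbf B$ realizing $\Sigma$ with $d_{\mathbf B}(n)=d_{\mathbf A}(n)$ for all $n\ge 1$; otherwise $\Sigma$ is *restrictive for finite algebras*. **Theorem.** Let $\Sigma$ be a set of basic identities in which only finitely many constant symbols occur. Consider the following statements. 1. $\Sigma$ is restrictive. 2. $\Sigma$ is restrictive for finite algebras. 3. The variety axiomatized by $\Sigma$ has a pointed cube term. 4. The variety axiomatized by $\Sigma$ has a pointed cube term of the form $F(x_1,\dots,x_m)$, where $m\ge 2$, $F$ is a function symbol occurring in $\Sigma$, and the variables $x_1,\dots,x_m$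 are distinct. 5. If $\mathbf A$ is an algebra realizing $\Sigma$ and $d_{\mathbf A}(n)$ is finite for all $n\ge 1$, then $d_{\mathbf A}(n)$ is bounded above by a polynomial in $n$ (for $n\ge 1$). 6. There is no algebra $\mathbf A$ realizing $\Sigma$ such that $d_{\mathbf A}(n)=2^n$ for all $n\ge 1$. 7. There is no finite algebra $\mathbf A$ realizing $\Sigma$ such that $d_{\mathbf A}(n)=2^n$ for all $n\ge 1$. Then (1), (2), (3), (5), (6), (7) are equivalent and (4) implies them. If $\Sigma$ is consistent, then (4) is also equivalent to them. -/

import Mathlib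

universe u

namespace GrowthRate

open FirstOrder.Language Cardinal

/-! ### The growth rate of an algebra -/

section Growth

variable (K : FirstOrder.Language.{u, u}) (A : Type u) [K.Structure A]

/-- The direct power `A ^ n`, with coordinatewise operations. -/
instance powStructure (n : ℕ) : K.Structure (Fin n → A) where
  funMap f a := fun i => Structure.funMap f (fun j => a j i)
  RelMap r a := ∀ i, Structure.RelMap r (fun j => a j i)

/-- `d_A(n)`: the least cardinality of a generating set of `A ^ n`. -/
noncomputable def d (n : ℕ) : Cardinal.{u} :=
  sInf {κ | ∃ G : Set (Fin n → A), Substructure.closure K G = ⊤ ∧ κ = #G}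

end Growth

/-! ### Terms and identities -/

section Terms

variable {L : FirstOrder.Language.{u, u}}

/-- The number of occurrences of nonnullary function symbols in a term. -/
def nonnullaryCount {α : Type*} : L.Term α → ℕ
  | .var _ => 0
  | @Term.func _ _ n _ ts => (if n = 0 then 0 else 1) + ∑ i : Fin n, nonnullaryCount (ts i)

/-- A term is basic if it contains at most one nonnullary function symbol. -/
def IsBasicTerm {α : Type*} (t : L.Term α) : Prop :=
  nonnullaryCount t ≤ 1

/-- The set of function symbols (with their arities, constants included) occurring in a term. -/
def termSymbols {α : Type*} : L.Term α → Set (Σ n, L.Functions n)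
  | .var _ => ∅
  | @Term.func _ _ n f ts => {⟨n, f⟩} ∪ ⋃ i : Fin n, termSymbols (ts i)

/-- An identity `s ≈ t`, the variables being indexed by the natural numbers. -/
abbrev Identity (L : FirstOrder.Language.{u, u}) : Type u := L.Term ℕ × L.Term ℕ

/-- An identity is basic if both of its sides are basic terms. -/
def IsBasic (e : Identity L) : Prop :=
  IsBasicTerm e.1 ∧ IsBasicTerm e.2

/-- The function symbols occurring in a set of identities. -/
def symbols (S : Set (Identity L)) : Set (Σ n, L.Functions n) :=
  ⋃ e ∈ S, termSymbols e.1 ∪ termSymbols e.2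

/-- The constant symbols occurring in a set of identities. -/
def constantsOf (S : Set (Identity L)) : Set L.Constants :=
  {c | (⟨0, c⟩ : Σ n, L.Functions n) ∈ symbols S}

/-- The identity `e` holds in `M`. -/
def Holds (M : Type u) [L.Structure M] (e : Identity L) : Prop :=
  ∀ v : ℕ → M, e.1.realize v = e.2.realize v

/-- `S ⊨ e`: every model of `S` is a model of `e`. -/
def Entails (S : Set (Identity L)) (e : Identity L) : Prop :=
  ∀ (M : Type u) [L.Structure M] [Nonempty M], (∀ e' ∈ S, Holds M e') → Holds M e

/-- `S` is consistent if it does not entail `x ≈ y` for distinct variables `x`, `y`. -/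
def Consistent (S : Set (Identity L)) : Prop :=
  ¬ Entails S (.var 0, .var 1)

/-- The algebra `B` in the language `K` realizes `S`: the function symbols occurring in `S` can be
interpreted by `K`-terms (a symbol of arity `n` by a term in `n` variables) in such a way that all
identities of `S` hold. The interpretation is recorded as an `L`-structure on `B`, whose operations
on symbols not occurring in `S` play no role. -/
def Realizes (S : Set (Identity L)) (K : FirstOrder.Language.{u, u}) (B : Type u) [K.Structure B] : Prop :=
  ∃ _ : L.Structure B,
    (∀ s ∈ symbols S, ∃ t : K.Term (Fin s.1),
      ∀ b : Fin s.1 → B, Structure.funMap s.2 b = t.realize b) ∧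
    ∀ e ∈ S, Holds B e

/-! ### Pointed cube terms -/

/-- A variable or a constant symbol, viewed as a term. -/
def entryTerm : ℕ ⊕ L.Constants → L.Term ℕ :=
  Sum.elim .var Constants.term

/-- The term `F(x₁, …, x_m)` is a `p`-pointed `k`-cube term for the variety axiomatized by `S`:
there is a `k × m` matrix (`k ≥ 1`) of variables and exactly `p` distinct constant symbols,
each column of which has an entry different from the variable `x` (the variable with index `0`),
such that `S` entails `F(r) ≈ x` for each row `r`. -/
def IsPointedCubeTerm (S : Set (Identity L)) (p k : ℕ) {m : ℕ} (F : L.Term (Fin m)) : Prop :=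
  1 ≤ k ∧ ∃ M : Fin k → Fin m → ℕ ⊕ L.Constants,
    {c : L.Constants | ∃ i j, M i j = Sum.inr c}.ncard = p ∧
    (∀ j, ∃ i, M i j ≠ Sum.inl 0) ∧
    ∀ i, Entails S (F.subst (fun j => entryTerm (M i j)), .var 0)

/-- The variety axiomatized by `S` has a pointed cube term. -/
def HasPointedCubeTerm (S : Set (Identity L)) : Prop :=
  ∃ (p k m : ℕ) (F : L.Term (Fin m)), IsPointedCubeTerm S p k F

/-- The variety axiomatized by `S` has a pointed cube term `F(x₁, …, x_m)` where `m ≥ 2`, `F` is a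
function symbol occurring in `S` and the variables are distinct. -/
def HasPointedCubeSymbol (S : Set (Identity L)) : Prop :=
  ∃ (p k m : ℕ) (F : L.Functions m), 2 ≤ m ∧ (⟨m, F⟩ : Σ n, L.Functions n) ∈ symbols S ∧
    IsPointedCubeTerm S p k (Term.func F Term.var)

/-! ### Restrictive sets of identities -/

/-- Some nonempty algebra realizing `S` has the `d`-function `D` on the positive integers. -/
def GrowthAttained (S : Set (Identity L)) (D : ℕ → Cardinal.{u}) : Prop :=
  ∃ (K : FirstOrder.Language.{u, u}) (_ : K.IsAlgebraic) (B : Type u) (_ : K.Structure B) (_ : Nonempty B),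
    Realizes S K B ∧ ∀ n, 1 ≤ n → d K B n = D n

/-- Some finite nonempty algebra realizing `S` has the `d`-function `D` on the positive
integers. -/
def FiniteGrowthAttained (S : Set (Identity L)) (D : ℕ → Cardinal.{u}) : Prop :=
  ∃ (K : FirstOrder.Language.{u, u}) (_ : K.IsAlgebraic) (B : Type u) (_ : K.Structure B) (_ : Nonempty B),
    Finite B ∧ Realizes S K B ∧ ∀ n, 1 ≤ n → d K B n = D n

/-- `S` is restrictive: it is not the case that the `d`-function of every algebra is the
`d`-function of some algebra realizing `S`. -/
def Restrictive (S : Set (Identity L)) : Prop :=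
  ¬ ∀ (K : FirstOrder.Language.{u, u}) [K.IsAlgebraic] (A : Type u) [K.Structure A] [Nonempty A],
    GrowthAttained S (d K A)

/-- `S` is restrictive for finite algebras: it is not the case that the `d`-function of every
finite algebra with more than one element is the `d`-function of some finite algebra
realizing `S`. -/
def RestrictiveForFinite (S : Set (Identity L)) : Prop :=
  ¬ ∀ (K : FirstOrder.Language.{u, u}) [K.IsAlgebraic] (A : Type u) [K.Structure A] [Finite A] [Nontrivial A],
    FiniteGrowthAttained S (d K A)

/-- Every algebra realizing `S` whose `d`-function takes finite values only has a `d`-function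
bounded above by a polynomial. -/
def ForcesPolynomialGrowth (S : Set (Identity L)) : Prop :=
  ∀ (K : FirstOrder.Language.{u, u}) [K.IsAlgebraic] (A : Type u) [K.Structure A] [Nonempty A],
    Realizes S K A → (∀ n, 1 ≤ n → d K A n < ℵ₀) →
      ∃ P : Polynomial ℕ, ∀ n, 1 ≤ n → d K A n ≤ ((P.eval n : ℕ) : Cardinal.{u})

end Terms

end GrowthRate

/-!
The argument turns on two facts.

*Pointed cube terms force polynomial growth.* Split the coordinates of `A ^ (k * q)` into `k` blocks
of length `q`. Applying row `i` of the cube term matrix on block `i` writes every tuple as the value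
of the cube term on tuples each of which is constant on some block. The tuples constant on a given
block form a copy of `A ^ ((k - 1) * q + 1)`, so `d (k * q) ≤ k * d ((k - 1) * q + 1)`
(`IsPointedCubeTerm.d_mul_le`). Shrinking the exponent by a constant factor costs a constant factor,
which gives a polynomial bound (`exists_polynomial_bound`).

*Without pointed cube terms there is no restriction.* Let `S` be consistent without pointed cube
symbol, and `A` a set. Cut the free model of `S` over `A ∪ {o}` down to the elements of `A ∪ {o}` and
the constants of `S`, replacing all other values of operations by `o`. Because the identities are
basic, no composition of operations is involved in them and the result is still a model
(`Atoms.isModel`). If a tuple over `A` is the value of a symbol on some tuples, then the identities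
that force its coordinates form the rows of a matrix; as this is not a cube term matrix, some column
is the variable `x` throughout, and the tuple is one of the arguments
(`exists_model_of_not_hasPointedCubeSymbol`). Hence, when `A` is an algebra, these operations do not
help to generate powers of `A`. Equipping the model `B` with all operations that do not help,
in the sense of `IsConservative`, gives `d_B = d_A`, provided that `A` has two elements from which
to build the tuples not over `A` (`d_conservative_le`). The one-element algebras are treated
separately in `not_restrictive`.

The same model, over a two-element set, turns a pointed cube term into a pointed cube symbol. The
growth rate `2 ^ n` is that of the two-element set without operations, and it is not polynomial.
-/

namespace GrowthRate

open FirstOrder FirstOrder.Language Cardinal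

/-! ### Generating sets of direct powers -/

section Generation

variable {K : FirstOrder.Language.{u, u}} {A : Type u} [K.Structure A]

theorem d_le_of_closure {n : ℕ} {G : Set (Fin n → A)} (hG : Substructure.closure K G = ⊤) :
    d K A n ≤ #G :=
  csInf_le' ⟨G, hG, rfl⟩

variable (K A) in
theorem exists_closure_eq_top (n : ℕ) :
    ∃ G : Set (Fin n → A), Substructure.closure K G = ⊤ ∧ d K A n = #G :=
  csInf_mem (s := {κ | ∃ G : Set (Fin n → A), Substructure.closure K G = ⊤ ∧ κ = #G})
    ⟨_, Set.univ, Substructure.closure_univ, rfl⟩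

theorem realize_pow {α : Type*} {n : ℕ} (t : K.Term α) (b : α → Fin n → A) (i : Fin n) :
    t.realize b i = t.realize (fun j => b j i) := by
  induction t with
  | var x => rfl
  | func f ts ih => exact congrArg (Structure.funMap f) (funext ih)

/-- If `a ↦ a ∘ φ` maps a generating set of `A ^ k` into a subalgebra of `A ^ n`, then it maps all
of `A ^ k` there: it is a homomorphism. -/
theorem comp_mem_of_closure {k n : ℕ} (φ : Fin n → Fin k) (U : K.Substructure (Fin n → A))
    {G : Set (Fin k → A)} (hG : Substructure.closure K G = ⊤) (hU : ∀ g ∈ G, g ∘ φ ∈ U)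
    (a : Fin k → A) : a ∘ φ ∈ U :=
  Substructure.closure_induction (p := fun a => a ∘ φ ∈ U) (hG ▸ Substructure.mem_top a) hU
    fun f _ hx => U.fun_mem f _ hx

theorem d_mono [Nonempty A] {n k : ℕ} (hnk : n ≤ k) : d K A n ≤ d K A k := by
  obtain ⟨G, hG, hd⟩ := exists_closure_eq_top K A k
  rw [hd]
  let φ : Fin n → Fin k := Fin.castLE hnk
  refine (d_le_of_closure (G := (fun g => g ∘ φ) '' G) ?_).trans mk_image_le
  refine eq_top_iff.2 fun b _ => ?_
  have hb : Function.extend φ b (fun _ => Classical.arbitrary A) ∘ φ = b :=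
    funext fun i => (Fin.castLE_injective hnk).extend_apply b _ i
  rw [← hb]
  exact comp_mem_of_closure φ _ hG
    (fun g hg => Substructure.subset_closure (Set.mem_image_of_mem _ hg)) _

theorem d_eq_zero_of_subsingleton [Subsingleton A] (c : K.Constants) (n : ℕ) : d K A n = 0 := by
  refine le_antisymm ((d_le_of_closure (G := ∅) ?_).trans (by simp)) (zero_le)
  refine eq_top_iff.2 fun b _ => ?_
  rw [Subsingleton.elim b (c : Fin n → A)]
  exact Substructure.constants_mem c

theorem d_eq_one_of_singleton [Nonempty A] [IsEmpty K.Constants] {n : ℕ} (g : Fin n → A)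
    (hg : Substructure.closure K {g} = ⊤) : d K A n = 1 := by
  refine le_antisymm ((d_le_of_closure hg).trans (by simp)) ?_
  rw [Cardinal.one_le_iff_ne_zero]
  intro h0
  obtain ⟨G, hG, hd⟩ := exists_closure_eq_top K A n
  rw [h0, eq_comm, mk_eq_zero_iff, Set.isEmpty_coe_sort] at hd
  subst hd
  refine Substructure.closure_induction (L := K) (p := fun _ => False)
    (hG ▸ Substructure.mem_top g) (by simp) fun {m} f x hx => ?_
  rcases m with _ | m
  · exact isEmptyElim (α := K.Constants) f
  · exact hx 0

end Generation

/-! ### Terms, models and consistency -/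

section Models

variable {L : FirstOrder.Language.{u, u}} {S : Set (Identity L)}

/-- `M` is a model of `S`. -/
def IsModel (S : Set (Identity L)) (M : Type u) [L.Structure M] : Prop :=
  ∀ e ∈ S, Holds M e

theorem Consistent.exists_model (h : Consistent S) :
    ∃ (M : Type u) (_ : L.Structure M) (v : ℕ → M), IsModel S M ∧ v 0 ≠ v 1 := by
  unfold Consistent Entails Holds at h
  push Not at h
  obtain ⟨M, i, -, hM, v, hv⟩ := h
  exact ⟨M, i, v, hM, hv⟩

theorem termSymbols_subset_of_mem {e : Identity L} (he : e ∈ S) :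
    termSymbols e.1 ⊆ symbols S ∧ termSymbols e.2 ⊆ symbols S :=
  ⟨fun _ hx => Set.mem_biUnion he (Or.inl hx), fun _ hx => Set.mem_biUnion he (Or.inr hx)⟩

theorem mem_termSymbols_func {α : Type*} {n : ℕ} (f : L.Functions n) (ts : Fin n → L.Term α) :
    (⟨n, f⟩ : Σ n, L.Functions n) ∈ termSymbols (Term.func f ts) :=
  Or.inl rfl

theorem termSymbols_arg_subset {α : Type*} {n : ℕ} (f : L.Functions n) (ts : Fin n → L.Term α)
    (i : Fin n) : termSymbols (ts i) ⊆ termSymbols (Term.func f ts) :=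
  fun _ hx => Or.inr (Set.mem_iUnion.2 ⟨i, hx⟩)

/-- The value of a term depends only on the interpretation of the symbols occurring in it. -/
theorem realize_congr_structure {α : Type*} {M : Type u} (s₁ s₂ : L.Structure M)
    {T : Set (Σ n, L.Functions n)}
    (h : ∀ (n : ℕ) (f : L.Functions n), (⟨n, f⟩ : Σ n, L.Functions n) ∈ T →
      ∀ x, s₁.funMap f x = s₂.funMap f x)
    (t : L.Term α) (ht : termSymbols t ⊆ T) (v : α → M) :
    @Term.realize L M s₁ α v t = @Term.realize L M s₂ α v t := by
  induction t with
  | var x => rfl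
  | func f ts ih =>
    refine (h _ f (ht (mem_termSymbols_func f ts)) _).trans ?_
    exact congrArg (s₂.funMap f)
      (funext fun i => ih i ((termSymbols_arg_subset f ts i).trans ht))

/-- In a cube term matrix with at most one column, some row avoids the variable `x` altogether, so
that the identity of this row makes `S` inconsistent. -/
theorem two_le_of_isPointedCubeTerm (hc : Consistent S) {p k m : ℕ} {F : L.Term (Fin m)}
    (hF : IsPointedCubeTerm S p k F) : 2 ≤ m := by
  by_contra! hm
  obtain ⟨hk, M, -, hcol, hrow⟩ := hF
  obtain ⟨i, hi⟩ : ∃ i, ∀ j, M i j ≠ Sum.inl 0 := by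
    rcases m with _ | m
    · exact ⟨⟨0, hk⟩, fun j => j.elim0⟩
    · obtain ⟨i, hi⟩ := hcol 0
      refine ⟨i, fun j => ?_⟩
      obtain rfl : j = 0 := Fin.ext (by simp; omega)
      exact hi
  obtain ⟨N, _, v, hN, hv⟩ := hc.exists_model
  have : Nonempty N := ⟨v 0⟩
  have key : ∀ w : ℕ → N, w 0 = F.realize fun j => (entryTerm (M i j)).realize w := fun w => by
    rw [← Term.realize_subst]
    exact (hrow i N hN w).symm
  refine hv ?_
  rw [show v 1 = Function.update v 0 (v 1) 0 by simp, key v, key (Function.update v 0 (v 1))]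
  congr 1
  funext j
  rcases h : M i j with x | c
  · have hx : x ≠ 0 := fun h0 => hi j (by rw [h, h0])
    simp [entryTerm, hx]
  · simp [entryTerm]

theorem consistent_of_not_hasPointedCubeTerm (h : ¬ HasPointedCubeTerm S) : Consistent S := by
  intro hS
  refine h ⟨_, 1, 1, Term.var 0, le_rfl, fun _ _ => Sum.inl 1, rfl, fun _ => ⟨0, by simp⟩,
    fun _ M _ _ hM v => ?_⟩
  have := hS M hM fun n => if n = 0 then v 1 else v 0
  simpa [entryTerm] using this

theorem HasPointedCubeSymbol.hasPointedCubeTerm (h : HasPointedCubeSymbol S) :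
    HasPointedCubeTerm S := by
  obtain ⟨p, k, m, F, -, -, hF⟩ := h
  exact ⟨p, k, m, _, hF⟩

end Models

/-! ### Models in which operations yield few tuples over a given set -/

section FreeModel

variable {L : FirstOrder.Language.{u, u}} {S : Set (Identity L)} {X A : Type u}

/-- `S` entails `s ≈ t`, for terms whose variables come from an arbitrary set `X`. -/
def EntailsEq (S : Set (Identity L)) (s t : L.Term X) : Prop :=
  ∀ (M : Type u) [L.Structure M] [Nonempty M], IsModel S M →
    ∀ v : X → M, s.realize v = t.realize v

theorem EntailsEq.refl (t : L.Term X) : EntailsEq S t t := fun _ _ _ _ _ => rfl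

theorem EntailsEq.symm {s t : L.Term X} (h : EntailsEq S s t) : EntailsEq S t s :=
  fun M _ _ hM v => (h M hM v).symm

theorem EntailsEq.trans {s t r : L.Term X} (h : EntailsEq S s t) (h' : EntailsEq S t r) :
    EntailsEq S s r :=
  fun M _ _ hM v => (h M hM v).trans (h' M hM v)

theorem EntailsEq.func {n : ℕ} (f : L.Functions n) {s t : Fin n → L.Term X}
    (h : ∀ i, EntailsEq S (s i) (t i)) : EntailsEq S (Term.func f s) (Term.func f t) :=
  fun M _ _ hM v => congrArg (Structure.funMap f) (funext fun i => h i M hM v)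

theorem entailsEq_of_mem {e : Identity L} (he : e ∈ S) (w : ℕ → L.Term X) :
    EntailsEq S (e.1.subst w) (e.2.subst w) := fun M _ _ hM v => by
  simpa [Term.realize_subst] using hM e he _

theorem Consistent.eq_of_entailsEq_var (hc : Consistent S) {x y : X}
    (h : EntailsEq S (Term.var x) (Term.var y)) : x = y := by
  classical
  by_contra hxy
  obtain ⟨M, _, v, hM, hv⟩ := hc.exists_model
  have : Nonempty M := ⟨v 0⟩
  refine hv ?_
  simpa [Ne.symm hxy] using h M hM fun z => if z = x then v 0 else v 1

/-- An element of `X` or a constant symbol occurring in `S`, as a term over `X`. -/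
def atomTerm (S : Set (Identity L)) (X : Type u) : X ⊕ constantsOf S → L.Term X :=
  Sum.elim Term.var fun c => Constants.term c.1

/-- Provable equality of atoms. -/
def atomSetoid (S : Set (Identity L)) (X : Type u) : Setoid (X ⊕ constantsOf S) where
  r a b := EntailsEq S (atomTerm S X a) (atomTerm S X b)
  iseqv := ⟨fun _ => .refl _, .symm, .trans⟩

/-- The elements of the free model of `S` over `X` that are represented by elements of `X` or by
constant symbols of `S`. -/
def Atoms (S : Set (Identity L)) (X : Type u) : Type u := Quotient (atomSetoid S X)

namespace Atoms

/-- The class of an atom. -/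
def mk (a : X ⊕ constantsOf S) : Atoms S X := Quotient.mk (atomSetoid S X) a

theorem mk_eq_mk {a b : X ⊕ constantsOf S} :
    (mk a : Atoms S X) = mk b ↔ EntailsEq S (atomTerm S X a) (atomTerm S X b) :=
  Quotient.eq (r := atomSetoid S X)

/-- A representative of a class of atoms. -/
noncomputable def out (b : Atoms S X) : X ⊕ constantsOf S := Quotient.out b

theorem mk_out (b : Atoms S X) : mk b.out = b := Quotient.out_eq b

/-- A term representing a class of atoms. -/
noncomputable def rep (b : Atoms S X) : L.Term X := atomTerm S X b.out

theorem finite [Finite X] (hS : (constantsOf S).Finite) : Finite (Atoms S X) := by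
  have := hS.to_subtype
  exact Quotient.finite _

open Classical in
/-- The class of an atom provably equal to the term `t`, and the class of `o` if there is none. -/
noncomputable def value (S : Set (Identity L)) (o : X) (t : L.Term X) : Atoms S X :=
  if h : ∃ a, EntailsEq S t (atomTerm S X a) then mk h.choose else mk (Sum.inl o)

theorem value_of_entailsEq {o : X} {t : L.Term X} {a : X ⊕ constantsOf S}
    (h : EntailsEq S t (atomTerm S X a)) : value S o t = mk a := by
  have h' : ∃ a, EntailsEq S t (atomTerm S X a) := ⟨a, h⟩
  rw [value, dif_pos h', mk_eq_mk]
  exact h'.choose_spec.symm.trans h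

theorem value_congr {o : X} {s t : L.Term X} (h : EntailsEq S s t) :
    value S o s = value S o t := by
  by_cases ht : ∃ a, EntailsEq S t (atomTerm S X a)
  · obtain ⟨a, ha⟩ := ht
    rw [value_of_entailsEq ha, value_of_entailsEq (h.trans ha)]
  · rw [value, value, dif_neg ht, dif_neg fun ⟨a, ha⟩ => ht ⟨a, h.symm.trans ha⟩]

theorem value_rep (o : X) (b : Atoms S X) : value S o b.rep = b :=
  (value_of_entailsEq (.refl _)).trans b.mk_out

theorem entailsEq_rep_value {o : X} {t : L.Term X} {a : X ⊕ constantsOf S}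
    (h : EntailsEq S t (atomTerm S X a)) : EntailsEq S (value S o t).rep t := by
  rw [value_of_entailsEq h]
  exact (mk_eq_mk.1 (mk_out (mk a : Atoms S X))).trans h.symm

open Classical in
/-- The operations of the free model, with the values outside `Atoms S X` replaced by `o`. Symbols
not occurring in `S` are interpreted as constant operations with value `o`. -/
@[reducible]
noncomputable def structureOf (S : Set (Identity L)) (o : X) : L.Structure (Atoms S X) where
  funMap {n} f b := if (⟨n, f⟩ : Σ n, L.Functions n) ∈ symbols S
    then value S o (Term.func f fun j => (b j).rep) else mk (Sum.inl o)
  RelMap _ _ := False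

theorem funMap_of_mem (o : X) {n : ℕ} {f : L.Functions n}
    (hf : (⟨n, f⟩ : Σ n, L.Functions n) ∈ symbols S) (b : Fin n → Atoms S X) :
    (structureOf S o).funMap f b = value S o (Term.func f fun j => (b j).rep) :=
  if_pos hf

/-- A term without nonnullary symbols is an atom after substitution of atoms. -/
theorem exists_atom_of_nonnullaryCount_eq_zero {t : L.Term ℕ} (ht : nonnullaryCount t = 0)
    (hs : termSymbols t ⊆ symbols S) (v : ℕ → Atoms S X) :
    ∃ a, t.subst (fun i => (v i).rep) = atomTerm S X a := by
  cases t with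
  | var i => exact ⟨(v i).out, rfl⟩
  | @func n f ts =>
    obtain rfl : n = 0 := by
      by_contra hn
      simp [nonnullaryCount, hn] at ht
    refine ⟨Sum.inr ⟨f, hs (mem_termSymbols_func f ts)⟩, ?_⟩
    simp only [Term.subst, atomTerm, Sum.elim_inr, Constants.term]
    congr 1
    exact Subsingleton.elim _ _

/-- Evaluation of basic terms agrees with evaluation in the free model. For terms with nested
nonnullary symbols this fails, as an inner value may have been replaced by `o`. -/
theorem realize_eq_value (o : X) {t : L.Term ℕ} (ht : IsBasicTerm t)
    (hs : termSymbols t ⊆ symbols S) (v : ℕ → Atoms S X) :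
    @Term.realize L _ (structureOf S o) _ v t = value S o (t.subst fun i => (v i).rep) := by
  let _ := structureOf S o
  induction t with
  | var i => exact (value_rep o (v i)).symm
  | @func n f ts ih =>
    have h0 : ∀ i, nonnullaryCount (ts i) = 0 := fun i => by
      have hn : n ≠ 0 := by rintro rfl; exact i.elim0
      have h1 : 1 + ∑ i, nonnullaryCount (ts i) ≤ 1 := by
        simpa [IsBasicTerm, nonnullaryCount, hn] using ht
      have h2 := Finset.single_le_sum (f := fun i => nonnullaryCount (ts i))
        (fun _ _ => Nat.zero_le _) (Finset.mem_univ i)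
      omega
    refine (funMap_of_mem o (hs (mem_termSymbols_func f ts)) _).trans (value_congr ?_)
    refine EntailsEq.func f fun i => ?_
    have hsi := (termSymbols_arg_subset f ts i).trans hs
    obtain ⟨a, ha⟩ := exists_atom_of_nonnullaryCount_eq_zero (h0 i) hsi v
    rw [ih i ((h0 i).le.trans zero_le_one) hsi]
    refine entailsEq_rep_value (a := a) ?_
    rw [ha]
    exact .refl _

theorem isModel (hbasic : ∀ e ∈ S, IsBasic e) (o : X) :
    @IsModel L S (Atoms S X) (structureOf S o) := fun e he v => by
  rw [realize_eq_value o (hbasic e he).1 (termSymbols_subset_of_mem he).1,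
    realize_eq_value o (hbasic e he).2 (termSymbols_subset_of_mem he).2]
  exact value_congr (entailsEq_of_mem he _)

end Atoms

/-- A consistent set of basic identities without pointed cube symbol has, for every set `A`, a
model containing `A` and one more element `o` such that a tuple over `A` is the value of an
operation on tuples only if it is one of its arguments: otherwise, the identities responsible for
the coordinates of the value are the rows of a cube term matrix. -/
theorem exists_model_of_not_hasPointedCubeSymbol (hbasic : ∀ e ∈ S, IsBasic e)
    (hc : Consistent S) (hcube : ¬ HasPointedCubeSymbol S) (A : Type u) :
    ∃ (B : Type u) (_ : L.Structure B) (ι : A → B) (o : B),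
      Function.Injective ι ∧ (∀ a, ι a ≠ o) ∧ IsModel S B ∧
      ((constantsOf S).Finite → Finite A → Finite B) ∧
      ∀ (n m : ℕ) (f : L.Functions m) (b : Fin m → Fin n → B) (a : Fin n → A), 1 ≤ n →
        (∀ i, Structure.funMap f (fun j => b j i) = ι (a i)) → ∃ j, ∀ i, b j i = ι (a i) := by
  classical
  let X := Option A
  let ι : A → Atoms S X := fun a => Atoms.mk (Sum.inl (some a))
  have hinj : ∀ x y : X, (Atoms.mk (Sum.inl x) : Atoms S X) = Atoms.mk (Sum.inl y) → x = y :=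
    fun x y h => hc.eq_of_entailsEq_var (Atoms.mk_eq_mk.1 h)
  refine ⟨Atoms S X, Atoms.structureOf S none, ι, Atoms.mk (Sum.inl none),
    fun a a' h => Option.some_injective _ (hinj _ _ h), fun a h => (by simpa using hinj _ _ h),
    Atoms.isModel hbasic none, fun hS hA => Atoms.finite hS, fun n m f b a hn hab => ?_⟩
  by_cases hf : (⟨m, f⟩ : Σ n, L.Functions n) ∈ symbols S
  swap
  · have h := hab ⟨0, hn⟩
    rw [show (Atoms.structureOf S none).funMap f _ = _ from if_neg hf] at h
    simpa using hinj _ _ h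
  have hent : ∀ i, EntailsEq S (Term.func f fun j => (b j i).rep) (Term.var (some (a i))) := by
    intro i
    have h := hab i
    rw [show (Atoms.structureOf S none).funMap f _ = _ from if_pos hf] at h
    by_cases h' : ∃ e, EntailsEq S (Term.func f fun j => (b j i).rep) (atomTerm S X e)
    · obtain ⟨e, he⟩ := h'
      rw [Atoms.value_of_entailsEq he] at h
      exact he.trans (Atoms.mk_eq_mk.1 h)
    · rw [Atoms.value, dif_neg h'] at h
      simpa using hinj _ _ h
  by_contra! hne
  -- In row `i`, the element `a i` becomes the variable `x`, and all other elements of `X` become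
  -- one other variable.
  let M : Fin n → Fin m → ℕ ⊕ L.Constants := fun i j =>
    (b j i).out.elim (fun x => if x = some (a i) then Sum.inl 0 else Sum.inl 1)
      fun c => Sum.inr c.1
  have hM : IsPointedCubeTerm S ({c : L.Constants | ∃ i j, M i j = Sum.inr c}.ncard) n
      (Term.func f Term.var) := by
    refine ⟨hn, M, rfl, fun j => ?_, fun i N _ _ hN w => ?_⟩
    · obtain ⟨i, hi⟩ := hne j
      refine ⟨i, fun h => hi ?_⟩
      rw [← Atoms.mk_out (b j i)]
      rcases hx : (b j i).out with x | c
      · by_cases hxa : x = some (a i)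
        · rw [hxa]
        · simp [M, hx, hxa] at h
      · simp [M, hx] at h
    · have h := hent i N hN fun x => if x = some (a i) then w 0 else w 1
      simp only [Term.realize_var, if_true] at h
      refine Eq.trans ?_ h
      refine congrArg (Structure.funMap f) (funext fun j => ?_)
      rcases hx : (b j i).out with x | c
      · by_cases hxa : x = some (a i) <;>
          simp [M, Atoms.rep, atomTerm, entryTerm, hx, hxa, Term.subst]
      · simp [M, Atoms.rep, atomTerm, entryTerm, hx, Term.subst]
  exact hcube ⟨_, n, m, f, two_le_of_isPointedCubeTerm hc hM, hf, hM⟩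

/-- In a model over a two-element set as above the property of operations passes to terms, so that
no term is a pointed cube term. -/
theorem hasPointedCubeSymbol_of_hasPointedCubeTerm (hbasic : ∀ e ∈ S, IsBasic e)
    (hc : Consistent S) (h : HasPointedCubeTerm S) : HasPointedCubeSymbol S := by
  by_contra hcube
  obtain ⟨p, k, m, F, hk, M, -, hcol, hrow⟩ := h
  obtain ⟨B, _, ι, o, hι, -, hB, -, hop⟩ :=
    exists_model_of_not_hasPointedCubeSymbol hbasic hc hcube (ULift.{u} Bool)
  have hterm : ∀ (t : L.Term (Fin m)) (b : Fin m → Fin k → B) (a : Fin k → ULift.{u} Bool),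
      (∀ i, t.realize (fun j => b j i) = ι (a i)) → ∃ j, ∀ i, b j i = ι (a i) := by
    intro t b a
    induction t with
    | var j => exact fun h => ⟨j, h⟩
    | func f ts ih =>
      intro h
      obtain ⟨j, hj⟩ := hop k _ f (fun l i => (ts l).realize fun j => b j i) a hk h
      exact ih j hj
  let w : ℕ → B := fun n => ι ⟨decide (n = 0)⟩
  have : Nonempty B := ⟨o⟩
  obtain ⟨j, hj⟩ := hterm F (fun j i => (entryTerm (M i j)).realize w) (fun _ => ⟨true⟩) fun i => by
    rw [← Term.realize_subst]
    exact hrow i B hB w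
  obtain ⟨i, hi⟩ := hcol j
  have hji := hj i
  rcases hx : M i j with x | c
  · rw [hx] at hji
    have := hι hji
    simp only [ULift.up.injEq, decide_eq_true_eq] at this
    exact hi (hx.trans (by rw [this]))
  · rw [hx] at hji
    obtain ⟨l, -⟩ := hop 1 0 c (fun l => l.elim0) (fun _ => ⟨true⟩) le_rfl fun _ => by
      rw [← hji]
      exact congrArg (Structure.funMap c) (Subsingleton.elim _ _)
    exact l.elim0

end FreeModel

/-! ### Pointed cube terms force polynomial growth -/

section Polynomial

/-- A monotone function shrinking its argument by a constant factor at the cost of a constant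
factor is polynomially bounded. -/
theorem exists_polynomial_bound {D : ℕ → ℕ} (hmono : Monotone D) {k : ℕ} (hk : 1 ≤ k)
    (hrec : ∀ q, D (k * q) ≤ k * D ((k - 1) * q + 1)) :
    ∃ C r : ℕ, ∀ n, 1 ≤ n → D n ≤ C * n ^ r := by
  obtain ⟨l, rfl⟩ : ∃ l, k = l + 1 := ⟨k - 1, by omega⟩
  simp only [Nat.add_sub_cancel] at hrec
  -- With `q = ⌈n / (l + 1)⌉`, the argument on the right is at most `(2l+1)/(2l+2) * n` for large
  -- `n`, and the exponent `r` makes up for the factor `l + 1`.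
  obtain ⟨r, hr⟩ : ∃ r : ℕ, (l + 1) * (2 * l + 1) ^ r ≤ (2 * l + 2) ^ r := by
    have h1 : (1 : ℝ) < (2 * l + 2) / (2 * l + 1) := by
      rw [one_lt_div (by positivity)]
      linarith
    obtain ⟨r, hr⟩ := pow_unbounded_of_one_lt ((l : ℝ) + 1) h1
    refine ⟨r, ?_⟩
    rw [div_pow, lt_div_iff₀ (by positivity)] at hr
    exact_mod_cast hr.le
  refine ⟨D (2 * l * l + 2 * l + 2), r, fun n => ?_⟩
  induction n using Nat.strong_induction_on with
  | _ n ih =>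
    intro hn
    by_cases hbig : n ≤ 2 * l * l + 2 * l + 2
    · exact (hmono hbig).trans (Nat.le_mul_of_pos_right _ (by positivity))
    · push Not at hbig
      set q := (n + l) / (l + 1) with hq
      have hq1 : n ≤ (l + 1) * q := by
        have := Nat.lt_div_mul_add (a := n + l) (b := l + 1) (by omega)
        rw [← hq] at this
        linarith
      have hq2 : (l + 1) * q ≤ n + l := Nat.mul_div_le _ _
      have hshrink : (2 * l + 2) * (l * q + 1) ≤ (2 * l + 1) * n := by nlinarith
      have hlt : l * q + 1 < n := by nlinarith
      have h1 : D n ≤ (l + 1) * (D (2 * l * l + 2 * l + 2) * (l * q + 1) ^ r) :=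
        ((hmono hq1).trans (hrec q)).trans (Nat.mul_le_mul_left _ (ih _ hlt (by omega)))
      have h2 := Nat.pow_le_pow_left hshrink r
      rw [mul_pow, mul_pow] at h2
      refine h1.trans ?_
      rw [mul_left_comm]
      refine Nat.mul_le_mul_left _ ?_
      have hpos : 0 < (2 * l + 2) ^ r := by positivity
      refine Nat.le_of_mul_le_mul_left ?_ hpos
      calc (2 * l + 2) ^ r * ((l + 1) * (l * q + 1) ^ r)
          = (l + 1) * ((2 * l + 2) ^ r * (l * q + 1) ^ r) := by ring
        _ ≤ (l + 1) * ((2 * l + 1) ^ r * n ^ r) := Nat.mul_le_mul_left _ h2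
        _ = ((l + 1) * (2 * l + 1) ^ r) * n ^ r := by ring
        _ ≤ (2 * l + 2) ^ r * n ^ r := Nat.mul_le_mul_right _ hr

theorem exists_eval_lt_two_pow (P : Polynomial ℕ) : ∃ n, 1 ≤ n ∧ P.eval n < 2 ^ n := by
  have h : Filter.Tendsto (fun n : ℕ => ((P.eval n : ℕ) : ℝ) / 2 ^ n) Filter.atTop (nhds 0) := by
    have h' : ∀ n : ℕ, ((P.eval n : ℕ) : ℝ) / 2 ^ n =
        ∑ i ∈ Finset.range (P.natDegree + 1), (P.coeff i : ℝ) * ((n : ℝ) ^ i / 2 ^ n) := fun n => by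
      rw [Polynomial.eval_eq_sum_range, Nat.cast_sum, Finset.sum_div]
      exact Finset.sum_congr rfl fun i _ => by push_cast; ring
    simp only [h']
    rw [show (0 : ℝ) = ∑ i ∈ Finset.range (P.natDegree + 1), (P.coeff i : ℝ) * 0 by simp]
    exact tendsto_finsetSum _ fun i _ =>
      (tendsto_pow_const_div_const_pow_of_one_lt i (by norm_num)).const_mul _
  obtain ⟨n, hn, hn1⟩ :=
    ((h.eventually (gt_mem_nhds one_pos)).and (Filter.eventually_ge_atTop 1)).exists
  refine ⟨n, hn1, ?_⟩
  rw [div_lt_one (by positivity)] at hn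
  exact_mod_cast hn

variable {L : FirstOrder.Language.{u, u}} {S : Set (Identity L)}
  {K : FirstOrder.Language.{u, u}} {A : Type u} [K.Structure A]

/-- If `S` is realized by `A`, the symbols not occurring in `S` can be interpreted in such a way
that the term operations preserve all subalgebras of powers of `A` that contain the diagonal. -/
theorem Realizes.exists_model [Nonempty A] (h : Realizes S K A) :
    ∃ _ : L.Structure A, IsModel S A ∧
      ∀ (N m : ℕ) (U : K.Substructure (Fin N → A)), (∀ a : A, (fun _ => a) ∈ U) →
        ∀ (t : L.Term (Fin m)) (b : Fin m → Fin N → A), (∀ j, b j ∈ U) →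
          (fun i => t.realize fun j => b j i) ∈ U := by
  classical
  obtain ⟨s, hs, hm⟩ := h
  let s' : L.Structure A :=
    { funMap := fun {n} f x => if (⟨n, f⟩ : Σ n, L.Functions n) ∈ symbols S then s.funMap f x
        else if h : 0 < n then x ⟨0, h⟩ else Classical.arbitrary A
      RelMap := fun _ _ => False }
  have hcongr := fun t => realize_congr_structure (α := ℕ) s' s (T := symbols S)
    (fun n f hf x => if_pos hf) t
  refine ⟨s', fun e he v => ?_, fun N m U hdiag t b hb => ?_⟩
  · have := termSymbols_subset_of_mem he
    rw [hcongr _ this.1, hcongr _ this.2]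
    exact hm e he v
  · induction t with
    | var j => exact hb j
    | @func n f ts ih =>
      by_cases hf : (⟨n, f⟩ : Σ n, L.Functions n) ∈ symbols S
      · obtain ⟨t, ht⟩ := hs _ hf
        have : (fun i => Term.realize (fun j => b j i) (Term.func f ts)) =
            t.realize fun l i => (ts l).realize fun j => b j i := by
          funext i
          rw [realize_pow, ← ht]
          exact if_pos hf
        rw [this]
        exact t.realize_mem _ ih
      · by_cases hn : 0 < n
        · convert ih ⟨0, hn⟩ using 2 with i
          exact (if_neg hf).trans (dif_pos hn)
        · convert hdiag (Classical.arbitrary A) using 2 with i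
          exact (if_neg hf).trans (dif_neg hn)

/-- The coordinates of `A ^ (k * q)` fall into `k` blocks of length `q`. Using row `i` of the matrix
on block `i`, the cube term produces an arbitrary tuple from tuples that are constant on some
block, and the tuples constant on a given block form a copy of `A ^ ((k - 1) * q + 1)`. -/
theorem IsPointedCubeTerm.d_mul_le [Nonempty A] {p k m : ℕ} {F : L.Term (Fin m)}
    (hF : IsPointedCubeTerm S p k F) (hA : Realizes S K A) (q : ℕ) :
    d K A (k * q) ≤ k * d K A ((k - 1) * q + 1) := by
  classical
  obtain ⟨hk, M, -, hcol, hrow⟩ := hF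
  obtain ⟨_, hmodel, hterm⟩ := hA.exists_model
  obtain ⟨G, hG, hd⟩ := exists_closure_eq_top K A ((k - 1) * q + 1)
  let β : Fin (k * q) → Fin k := fun t => (finProdFinEquiv.symm t).1
  -- `φ i` collapses block `i` to one point.
  have hφ : ∀ i : Fin k, ∃ φ : Fin (k * q) → Fin ((k - 1) * q + 1),
      ∀ s t, φ s = φ t → s = t ∨ β s = i ∧ β t = i := by
    intro i
    have hcard : Fintype.card (Option ({l : Fin k // l ≠ i} × Fin q)) = (k - 1) * q + 1 := by
      simp [Fintype.card_subtype_compl]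
    let e := Fintype.equivFinOfCardEq hcard
    refine ⟨fun t => e (if h : β t = i then none else some (⟨β t, h⟩, (finProdFinEquiv.symm t).2)),
      fun s t hst => ?_⟩
    have hst := e.injective hst
    by_cases hs : β s = i <;> by_cases ht : β t = i
    · exact Or.inr ⟨hs, ht⟩
    · simp [hs, ht] at hst
    · simp [hs, ht] at hst
    · left
      simp only [hs, ht, dif_neg, not_false_eq_true, Option.some.injEq, Prod.mk.injEq,
        Subtype.mk.injEq] at hst
      exact finProdFinEquiv.symm.injective (Prod.ext hst.1 hst.2)
  choose φ hφ using hφ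
  let G' : Set (Fin (k * q) → A) := ⋃ i, (fun g => g ∘ φ i) '' G
  have hmem : ∀ (i : Fin k) (b : Fin (k * q) → A), (∀ s t, β s = i → β t = i → b s = b t) →
      b ∈ Substructure.closure K G' := by
    intro i b hb
    have hfac : Function.FactorsThrough b (φ i) := fun s t hst =>
      (hφ i s t hst).elim (fun h => congrArg b h) fun h => hb s t h.1 h.2
    have : Function.extend (φ i) b (fun _ => Classical.arbitrary A) ∘ φ i = b :=
      funext fun t => hfac.extend_apply _ t
    rw [← this]
    exact comp_mem_of_closure (φ i) _ hG (fun g hg => Substructure.subset_closure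
      (Set.mem_iUnion.2 ⟨i, Set.mem_image_of_mem _ hg⟩)) _
  refine (d_le_of_closure (G := G') (eq_top_iff.2 fun a _ => ?_)).trans ?_
  · let b : Fin m → Fin (k * q) → A := fun j t => (entryTerm (M (β t) j)).realize
      fun x => if x = 0 then a t else Classical.arbitrary A
    have hb : ∀ j, b j ∈ Substructure.closure K G' := by
      intro j
      obtain ⟨i, hi⟩ := hcol j
      refine hmem i _ fun s t hs ht => ?_
      simp only [b, hs, ht]
      rcases hx : M i j with x | c
      · have hx0 : x ≠ 0 := fun h => hi (by rw [hx, h])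
        simp [entryTerm, hx0]
      · simp [entryTerm]
    convert hterm _ _ _ (fun a => hmem ⟨0, hk⟩ _ fun _ _ _ _ => rfl) F b hb using 1
    funext t
    rw [← Term.realize_subst]
    exact (hrow (β t) A hmodel fun x => if x = 0 then a t else Classical.arbitrary A).symm
  · calc #G' ≤ Cardinal.sum fun i : Fin k => #((fun g => g ∘ φ i) '' G) := by
          simpa using mk_iUnion_le_sum_mk_lift (f := fun i : Fin k => (fun g => g ∘ φ i) '' G)
      _ ≤ Cardinal.sum fun _ : Fin k => #G := Cardinal.sum_le_sum _ _ fun i => mk_image_le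
      _ = k * d K A ((k - 1) * q + 1) := by rw [hd]; simp

theorem HasPointedCubeTerm.forcesPolynomialGrowth (h : HasPointedCubeTerm S) :
    ForcesPolynomialGrowth S := by
  obtain ⟨p, k, m, F, hF⟩ := h
  intro K _ A _ _ hA hfin
  have hfin' : ∀ n, d K A n < ℵ₀ := fun n => (d_mono n.le_succ).trans_lt (hfin _ (by omega))
  have hcast : ∀ n, (((d K A n).toNat : ℕ) : Cardinal.{u}) = d K A n := fun n =>
    cast_toNat_of_lt_aleph0 (hfin' n)
  obtain ⟨C, r, hC⟩ := exists_polynomial_bound (D := fun n => (d K A n).toNat)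
    (fun n n' h => toNat_le_toNat (d_mono h) (hfin' n')) hF.1 fun q => by
      have := hF.d_mul_le hA q
      rw [← hcast, ← hcast ((k - 1) * q + 1)] at this
      exact_mod_cast this
  refine ⟨Polynomial.C C * Polynomial.X ^ r, fun n hn => ?_⟩
  rw [← hcast, Nat.cast_le]
  simpa using hC n hn

theorem ForcesPolynomialGrowth.not_growthAttained_two_pow (h : ForcesPolynomialGrowth S) :
    ¬ GrowthAttained S (fun n => 2 ^ n) := by
  rintro ⟨K, _, B, _, _, hB, hd⟩
  obtain ⟨P, hP⟩ := h K B hB fun n hn => by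
    rw [hd n hn]
    exact_mod_cast natCast_lt_aleph0 (n := 2 ^ n)
  obtain ⟨n, hn, hlt⟩ := exists_eval_lt_two_pow P
  have := hP n hn
  simp only [hd n hn] at this
  exact absurd hlt (not_lt.2 (by exact_mod_cast this))

end Polynomial

/-! ### Extending an algebra without changing its growth rate -/

section Extension

variable {K : FirstOrder.Language.{u, u}} {A : Type u} [K.Structure A] {B : Type u} {ι : A → B}

variable (K ι) in
/-- An operation on `B` is conservative over the algebra `A` (embedded in `B` by `ι`) if, applied
to tuples, it yields no tuple over `A` beyond the subalgebra generated by those of its arguments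
that are tuples over `A`. Powers with exponent `0` are excluded, as there every constant operation
yields a tuple over `A`. -/
def IsConservative {m : ℕ} (f : (Fin m → B) → B) : Prop :=
  ∀ (n : ℕ) (U : K.Substructure (Fin n → A)) (b : Fin m → Fin n → B) (a : Fin n → A), 1 ≤ n →
    (∀ j c, (∀ i, b j i = ι (c i)) → c ∈ U) → (∀ i, f (fun j => b j i) = ι (a i)) → a ∈ U

variable (K ι) in
/-- The language of all conservative operations. -/
def conservativeLanguage : FirstOrder.Language.{u, u} where
  Functions m := {f : (Fin m → B) → B // IsConservative K ι f}
  Relations _ := PEmpty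

instance : (conservativeLanguage K ι).IsAlgebraic := fun _ => inferInstanceAs (IsEmpty PEmpty)

variable (K ι) in
/-- `B` with all conservative operations. -/
@[reducible]
def conservativeStructure : (conservativeLanguage K ι).Structure B where
  funMap f b := f.1 b
  RelMap r _ := r.elim

attribute [local instance] conservativeStructure

theorem d_le_d_conservative (hι : Function.Injective ι) {n : ℕ} (hn : 1 ≤ n) :
    d K A n ≤ d (conservativeLanguage K ι) B n := by
  obtain ⟨G, hG, hd⟩ := exists_closure_eq_top (conservativeLanguage K ι) B n
  let G' : Set (Fin n → A) := {a | ι ∘ a ∈ G}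
  refine (d_le_of_closure (G := G') (eq_top_iff.2 fun a _ => ?_)).trans ?_
  · refine Substructure.closure_induction (L := conservativeLanguage K ι)
      (p := fun b => ∀ c : Fin n → A, (∀ i, b i = ι (c i)) → c ∈ Substructure.closure K G')
      (hG ▸ Substructure.mem_top (ι ∘ a)) (fun g hg c hc => ?_) (fun f x hx c hc => ?_) a
      fun _ => rfl
    · exact Substructure.subset_closure (show ι ∘ c ∈ G from (funext hc : g = ι ∘ c) ▸ hg)
    · exact f.2 n _ x c hn hx hc
  · rw [hd]
    exact mk_le_of_injective (f := fun a : G' => (⟨ι ∘ a.1, a.2⟩ : G)) fun a a' h =>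
      Subtype.ext (hι.comp_left (congrArg Subtype.val h))

variable (K) in
open Classical in
/-- The operation of `A`, extended to `B` with the value `o` on the remaining arguments. -/
noncomputable def extendOp (ι : A → B) (o : B) {m : ℕ} (f : K.Functions m) (b : Fin m → B) : B :=
  if h : ∀ j, ∃ a, b j = ι a then ι (Structure.funMap f fun j => (h j).choose) else o

theorem extendOp_apply (hι : Function.Injective ι) (o : B) {m : ℕ} (f : K.Functions m)
    (a : Fin m → A) : extendOp K ι o f (fun j => ι (a j)) = ι (Structure.funMap f a) := by
  have h : ∀ j, ∃ a', ι (a j) = ι a' := fun j => ⟨a j, rfl⟩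
  rw [extendOp, dif_pos h]
  exact congrArg (fun x => ι (Structure.funMap f x))
    (funext fun j => (hι (h j).choose_spec).symm)

theorem isConservative_extendOp (hι : Function.Injective ι) {o : B} (ho : ∀ a, ι a ≠ o) {m : ℕ}
    (f : K.Functions m) : IsConservative K ι (extendOp K ι o f) := by
  intro n U b a _ hb hab
  have h : ∀ i j, ∃ c, b j i = ι c := fun i => by
    by_contra hi
    have := hab i
    rw [extendOp, dif_neg hi] at this
    exact ho _ this.symm
  choose c hc using h
  have ha : a = Structure.funMap f fun j i => c i j := by
    funext i
    refine hι ((hab i).symm.trans ?_)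
    rw [funext (hc i), extendOp_apply hι]
    rfl
  rw [ha]
  exact U.fun_mem f _ fun j => hb j _ fun i => hc i j

theorem isConservative_const {z : B} (hz : ∀ a, ι a ≠ z) :
    IsConservative K ι fun _ : Fin 0 → B => z :=
  fun _ _ _ _ hn _ hab => absurd (hab ⟨0, hn⟩).symm (hz _)

open Classical in
/-- The operation `(x, y, w, z) ↦ if y = w then x else z`, except that it avoids new values in
`A`. -/
noncomputable def switchOp (ι : A → B) (o : B) (b : Fin 4 → B) : B :=
  if b 1 = b 2 then b 0 else if b 3 ∈ Set.range ι then o else b 3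

theorem isConservative_switchOp {o : B} (ho : ∀ a, ι a ≠ o) :
    IsConservative K ι (switchOp ι o) := by
  intro n U b a _ hb hab
  refine hb 0 a fun i => ?_
  have h := hab i
  by_cases h1 : b 1 i = b 2 i
  · rwa [switchOp, if_pos h1] at h
  · rw [switchOp, if_neg h1] at h
    by_cases h2 : b 3 i ∈ Set.range ι
    · rw [if_pos h2] at h
      exact absurd h.symm (ho _)
    · rw [if_neg h2] at h
      exact absurd ⟨_, h.symm⟩ h2

theorem d_conservative_le [Nontrivial A] (hι : Function.Injective ι) {o : B}
    (ho : ∀ a, ι a ≠ o) (n : ℕ) : d (conservativeLanguage K ι) B n ≤ d K A n := by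
  classical
  obtain ⟨G, hG, hd⟩ := exists_closure_eq_top K A n
  rw [hd]
  let G' : Set (Fin n → B) := (fun g => ι ∘ g) '' G
  let V := Substructure.closure (conservativeLanguage K ι) G'
  have hA : ∀ a : Fin n → A, ι ∘ a ∈ V := fun a => by
    refine Substructure.closure_induction (L := K) (p := fun a => ι ∘ a ∈ V)
      (hG ▸ Substructure.mem_top a)
      (fun g hg => Substructure.subset_closure (Set.mem_image_of_mem _ hg)) fun f x hx => ?_
    refine (congrArg (· ∈ V) ?_).mpr (V.fun_mem
      (⟨_, isConservative_extendOp hι ho f⟩ : (conservativeLanguage K ι).Functions _)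
      (fun j => ι ∘ x j) hx)
    exact funext fun i => (extendOp_apply hι o f fun j => x j i).symm
  have hdiag : ∀ z : B, z ∉ Set.range ι → (fun _ => z) ∈ V := fun z hz =>
    V.fun_mem (⟨_, isConservative_const fun a h => hz ⟨a, h⟩⟩ :
      (conservativeLanguage K ι).Functions 0) Fin.elim0 fun j => j.elim0
  obtain ⟨a₀, a₁, ha⟩ := exists_pair_ne A
  -- The coordinates outside `A` are put in one after the other.
  have hall : ∀ (s : Finset (Fin n)) (b : Fin n → B), (∀ i ∉ s, b i ∈ Set.range ι) → b ∈ V := by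
    intro s
    induction s using Finset.induction_on with
    | empty =>
      intro b hb
      choose a ha using fun i => hb i (Finset.notMem_empty i)
      rw [← funext ha]
      exact hA a
    | insert i s _ ih =>
      intro b hb
      by_cases hi : b i ∈ Set.range ι
      · refine ih b fun l hl => ?_
        by_cases hli : l = i
        · exact hli ▸ hi
        · exact hb l (by simp [hl, hli])
      · have h0 : Function.update b i (ι a₀) ∈ V := ih _ fun l hl => by
          by_cases hli : l = i
          · simp [hli]
          · simpa [hli] using hb l (by simp [hl, hli])
        refine (congrArg (· ∈ V) ?_).mpr (V.fun_mem
          (⟨_, isConservative_switchOp ho⟩ : (conservativeLanguage K ι).Functions 4)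
          ![Function.update b i (ι a₀), ι ∘ fun _ => a₀,
            ι ∘ Function.update (fun _ => a₀) i a₁, fun _ => b i] ?_)
        · funext l
          change b l = switchOp ι o fun j => (![Function.update b i (ι a₀), ι ∘ fun _ => a₀,
            ι ∘ Function.update (fun _ => a₀) i a₁, fun _ => b i] : Fin 4 → Fin n → B) j l
          by_cases hli : l = i
          · subst hli
            simp [switchOp, hι.eq_iff, ha, hi]
          · simp [switchOp, hli]
        · intro j
          fin_cases j
          · exact h0
          · exact hA _
          · exact hA _
          · exact hdiag _ hi
  refine (d_le_of_closure (G := G') (eq_top_iff.2 fun b _ => ?_)).trans mk_image_le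
  exact hall Finset.univ b fun i hi => absurd (Finset.mem_univ i) hi

variable {L : FirstOrder.Language.{u, u}} {S : Set (Identity L)}

variable (K A) in
theorem exists_realizes_d_eq [Nontrivial A] (hbasic : ∀ e ∈ S, IsBasic e)
    (h : ¬ HasPointedCubeTerm S) :
    ∃ (K' : FirstOrder.Language.{u, u}) (_ : K'.IsAlgebraic) (B : Type u) (_ : K'.Structure B)
      (_ : Nonempty B), ((constantsOf S).Finite → Finite A → Finite B) ∧ Realizes S K' B ∧
        ∀ n, 1 ≤ n → d K' B n = d K A n := by
  obtain ⟨B, sB, ι, o, hι, ho, hB, hfin, hop⟩ := exists_model_of_not_hasPointedCubeSymbol hbasic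
    (consistent_of_not_hasPointedCubeTerm h) (fun h' => h h'.hasPointedCubeTerm) A
  have hcons : ∀ {m : ℕ} (f : L.Functions m),
      IsConservative K ι fun b : Fin m → B => Structure.funMap f b := fun f n U b a hn hb hab => by
    obtain ⟨j, hj⟩ := hop n _ f b a hn hab
    exact hb j a hj
  exact ⟨conservativeLanguage K ι, inferInstance, B, inferInstance, ⟨o⟩, hfin,
    ⟨sB, fun s _ => ⟨Term.func (⟨_, hcons s.2⟩ : (conservativeLanguage K ι).Functions s.1) Term.var,
      fun _ => rfl⟩, hB⟩,
    fun n hn => (d_conservative_le hι ho n).antisymm (d_le_d_conservative hι hn)⟩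

end Extension

/-! ### Comparison with special algebras -/

section Examples

variable {L : FirstOrder.Language.{u, u}} {S : Set (Identity L)}

/-- One-element algebras with a constant symbol realize every set of identities. -/
theorem growthAttained_zero : GrowthAttained S fun _ => 0 := by
  let K : FirstOrder.Language.{u, u} := ⟨fun _ => PUnit, fun _ => PEmpty⟩
  let sK : K.Structure PUnit.{u + 1} := ⟨fun _ _ => PUnit.unit, fun r _ => r.elim⟩
  let sL : L.Structure PUnit.{u + 1} := ⟨fun _ _ => PUnit.unit, fun _ _ => False⟩
  exact ⟨K, fun _ => inferInstanceAs (IsEmpty PEmpty), PUnit, sK, inferInstance,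
    ⟨sL, fun _ _ => ⟨Term.func PUnit.unit Term.var, fun _ => rfl⟩, fun _ _ _ => rfl⟩,
    fun n _ => d_eq_zero_of_subsingleton (K := K) PUnit.unit n⟩

/-- The language with all unary operations on `ℕ`. -/
def unaryLanguage : FirstOrder.Language.{u, u} where
  Functions m := {_f : ULift.{u} (ℕ → ℕ) // m = 1}
  Relations _ := PEmpty

instance : unaryLanguage.{u}.IsAlgebraic := fun _ => inferInstanceAs (IsEmpty PEmpty)

instance : IsEmpty unaryLanguage.{u}.Constants := ⟨fun f => absurd f.2 (by decide)⟩

instance : unaryLanguage.{u}.Structure (ULift.{u} ℕ) where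
  funMap f x := ⟨f.1.down (x ⟨0, by rw [f.2]; exact one_pos⟩).down⟩
  RelMap r _ := r.elim

/-- Every tuple is the image of `(0, 1, …, n - 1)` under a unary operation. -/
theorem d_unaryLanguage (n : ℕ) : d unaryLanguage.{u} (ULift.{u} ℕ) n = 1 := by
  refine d_eq_one_of_singleton (fun i => ⟨i⟩) (eq_top_iff.2 fun b _ => ?_)
  let g : ℕ → ℕ := fun l => if h : l < n then (b ⟨l, h⟩).down else 0
  let V := Substructure.closure unaryLanguage.{u} {fun i : Fin n => (⟨i⟩ : ULift.{u} ℕ)}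
  refine (congrArg (· ∈ V) ?_).mpr (V.fun_mem (⟨⟨g⟩, rfl⟩ : unaryLanguage.{u}.Functions 1)
    (fun _ i => ⟨i⟩) fun _ => Substructure.subset_closure rfl)
  funext i
  refine ULift.ext _ _ ?_
  change (b i).down = g i
  simp [g]

/-- The language without symbols. -/
def pureLanguage : FirstOrder.Language.{u, u} := ⟨fun _ => PEmpty, fun _ => PEmpty⟩

instance : pureLanguage.{u}.IsAlgebraic := fun _ => inferInstanceAs (IsEmpty PEmpty)

instance : pureLanguage.{u}.Structure (ULift.{u} Bool) := ⟨fun f _ => f.elim, fun r _ => r.elim⟩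

/-- Without operations, only the whole power generates it. -/
theorem d_pureLanguage : d pureLanguage.{u} (ULift.{u} Bool) = fun n => 2 ^ n := by
  funext n
  have hcard : #(Fin n → ULift.{u} Bool) = 2 ^ n := by simp
  refine le_antisymm ((d_le_of_closure Substructure.closure_univ).trans ?_) ?_
  · rw [mk_univ, hcard]
  · obtain ⟨G, hG, hd⟩ := exists_closure_eq_top pureLanguage.{u} (ULift.{u} Bool) n
    have : G = Set.univ := Set.eq_univ_of_forall fun b =>
      Substructure.closure_induction (L := pureLanguage) (p := (· ∈ G))
        (hG ▸ Substructure.mem_top b) (fun _ h => h) fun f _ _ => PEmpty.elim f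
    rw [hd, this, mk_univ, hcard]

/-- One-element algebras without constant symbols have the growth rate `1` of an infinite algebra,
which has to take their place if `S` contains constant symbols. -/
theorem not_restrictive (hbasic : ∀ e ∈ S, IsBasic e) (h : ¬ HasPointedCubeTerm S) :
    ¬ Restrictive S := by
  refine not_not.2 fun K _ A _ _ => ?_
  rcases subsingleton_or_nontrivial A with hA | hA
  · rcases isEmpty_or_nonempty K.Constants with hK | ⟨⟨c⟩⟩
    · obtain ⟨K', h1, B, h2, h3, -, hB, hd⟩ :=
        exists_realizes_d_eq unaryLanguage (ULift.{u} ℕ) hbasic h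
      refine ⟨K', h1, B, h2, h3, hB, fun n hn => ?_⟩
      rw [hd n hn, d_unaryLanguage,
        d_eq_one_of_singleton (fun _ : Fin n => Classical.arbitrary A)]
      exact eq_top_iff.2 fun b _ => Substructure.subset_closure (Subsingleton.elim _ _)
    · rw [show d K A = fun _ => 0 from funext fun n => d_eq_zero_of_subsingleton c n]
      exact growthAttained_zero
  · obtain ⟨K', h1, B, h2, h3, -, hB, hd⟩ := exists_realizes_d_eq K A hbasic h
    exact ⟨K', h1, B, h2, h3, hB, hd⟩

theorem not_restrictiveForFinite (hbasic : ∀ e ∈ S, IsBasic e) (hconst : (constantsOf S).Finite)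
    (h : ¬ HasPointedCubeTerm S) : ¬ RestrictiveForFinite S := by
  refine not_not.2 fun K _ A _ hA _ => ?_
  obtain ⟨K', h1, B, h2, h3, hfin, hB, hd⟩ := exists_realizes_d_eq K A hbasic h
  exact ⟨K', h1, B, h2, h3, hfin hconst hA, hB, hd⟩

theorem FiniteGrowthAttained.growthAttained {D : ℕ → Cardinal.{u}}
    (h : FiniteGrowthAttained S D) : GrowthAttained S D := by
  obtain ⟨K, h1, B, h2, h3, -, h⟩ := h
  exact ⟨K, h1, B, h2, h3, h⟩

theorem restrictive_of_not_growthAttained_two_pow (h : ¬ GrowthAttained S fun n => 2 ^ n) :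
    Restrictive S :=
  fun hS => h (d_pureLanguage ▸ hS pureLanguage (ULift.{u} Bool))

theorem restrictiveForFinite_of_not_finiteGrowthAttained_two_pow
    (h : ¬ FiniteGrowthAttained S fun n => 2 ^ n) : RestrictiveForFinite S :=
  fun hS => h (d_pureLanguage ▸ hS pureLanguage (ULift.{u} Bool))

end Examples

end GrowthRate

theorem theorem4p10 (L : FirstOrder.Language.{u, u}) [L.IsAlgebraic]
    (S : Set (GrowthRate.Identity L))
    (hbasic : ∀ e ∈ S, GrowthRate.IsBasic e)
    (hconst : (GrowthRate.constantsOf S).Finite) :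
    [GrowthRate.Restrictive S,
     GrowthRate.RestrictiveForFinite S,
     GrowthRate.HasPointedCubeTerm S,
     GrowthRate.ForcesPolynomialGrowth S,
     ¬ GrowthRate.GrowthAttained S (fun n => 2 ^ n),
     ¬ GrowthRate.FiniteGrowthAttained S (fun n => 2 ^ n)].TFAE ∧
    (GrowthRate.HasPointedCubeSymbol S → GrowthRate.HasPointedCubeTerm S) ∧
    (GrowthRate.Consistent S →
      (GrowthRate.HasPointedCubeTerm S → GrowthRate.HasPointedCubeSymbol S)) := by
  refine ⟨?_, fun h => h.hasPointedCubeTerm,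
    GrowthRate.hasPointedCubeSymbol_of_hasPointedCubeTerm hbasic⟩
  tfae_have 1 → 3 := fun h => by_contra fun h3 => GrowthRate.not_restrictive hbasic h3 h
  tfae_have 2 → 3 := fun h =>
    by_contra fun h3 => GrowthRate.not_restrictiveForFinite hbasic hconst h3 h
  tfae_have 3 → 4 := fun h => h.forcesPolynomialGrowth
  tfae_have 4 → 5 := fun h => h.not_growthAttained_two_pow
  tfae_have 5 → 6 := fun h h' => h h'.growthAttained
  tfae_have 5 → 1 := GrowthRate.restrictive_of_not_growthAttained_two_pow
  tfae_have 6 → 2 := GrowthRate.restrictiveForFinite_of_not_finiteGrowthAttained_two_pow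
  tfae_finish
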